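/- Let $n \ge 3$, let $g_1, \dots, g_n$ be (possibly multivariate) polynomials over $\mathbb{C}$, let $e_1, \dots, e_n \ge 1$ be integers, and put $f_i = g_i^{e_i}$. Assume that $$f_1 + f_2 + \cdots + f_n = g_1^{e_1} + g_2^{e_2} + \cdots + g_n^{e_n} = 0,$$ that the $f_i$ are not all constant, and that for every nonempty set of indices $1 \le i_1 < i_2 < \cdots < i_s \le n$, $$f_{i_1} + f_{i_2} + \cdots + f_{i_s} = 0 \implies \gcd\{f_{i_1}, f_{i_2}, \dots, f_{i_s}\} = 1.$$ Let $d$ be the dimension of the vector space over $\mathbb{C}$ spanned by $f_1, \dots, f_n$. Then $d \ge 2$ and $$\sum_{i=1}^n \frac{1}{e_i} > \frac{1}{d-1}.$$ -/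

import Mathlib

/-- The greatest common divisor of the polynomials `f i`, `i ∈ I`, is `1` (up to units):
every common divisor is a unit. -/
def GcdEqOne {l n : ℕ} (I : Finset (Fin n)) (f : Fin n → MvPolynomial (Fin l) ℂ) : Prop :=
  ∀ p : MvPolynomial (Fin l) ℂ, (∀ i ∈ I, p ∣ f i) → IsUnit p

/-- The hypotheses of the generalized Mason theorem on polynomials `f_1, …, f_n` in `l` variables
over `ℂ`: there are at least three of them, not all are constant, their sum vanishes, and every
nonempty vanishing subsum has greatest common divisor `1`. -/
structure MasonConditions {l n : ℕ} (f : Fin n → MvPolynomial (Fin l) ℂ) : Prop where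
  three_le : 3 ≤ n
  not_all_constant : ¬ ∀ i, ∃ c : ℂ, f i = MvPolynomial.C c
  sum_eq_zero : ∑ i, f i = 0
  gcd_eq_one : ∀ I : Finset (Fin n), I.Nonempty → ∑ i ∈ I, f i = 0 → GcdEqOne I f

/-! Working over the fraction field `K` of the polynomials in all variables but one reduces
everything to one variable in characteristic zero. Gauss's lemma keeps the gcd hypothesis, and the
dimension can only drop, which strengthens the bound. In one variable, fix a nonconstant `f m`. Let
`E` be an index set containing `m`, with span of dimension `d` and with `W` the Wronskian of a
basis. `W` depends on the basis only up to a constant, so for every basis `B ⊆ E` the product of the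
`f i` over `B` divides `W * ∏ g i ^ (d - 1)`. Multiplying by the product over `E \ B` and taking the
gcd over all `B` gives `∏ f i ∣ G * W * ∏ g i ^ (d - 1)`, where `G` is a multiple of the gcd of the
complementary products. As `deg W < ∑_B deg (f i)`, the degree `δ` of one complementary product is
less than `deg G + (d - 1) * ∑ deg (g i)`. The combinatorial input is `D + deg G ≤ δ + deg H`, where
`D` bounds the degrees and `H` is a common divisor. It survives the adjunction of ears, starting
from `{m}`, until the sum over `E` vanishes; then `H` is a unit and `D < (d - 1) * ∑ deg (g i)`.
Finally `deg (g i) ≤ D / e i`. -/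

/-- The Wronskian matrix of a tuple of polynomials. -/
noncomputable def wronskianMatrix {K : Type*} [Field K] {n : ℕ} (b : Fin n → Polynomial K) :
    Matrix (Fin n) (Fin n) (Polynomial K) :=
  Matrix.of fun k i => Polynomial.derivative^[k] (b i)

/-! ### Wronskians: nonvanishing, degree, divisibility. -/

section
open Polynomial

variable {K : Type*} [Field K]

/-- If some nonzero vector of polynomials lies in a set closed under the derivative, then a nonzero
constant vector does. -/
theorem exists_constant_vector_of_derivative_closed [CharZero K] {n : ℕ}
    (S : Set (Fin n → K[X])) (hS : ∀ a ∈ S, (fun i => derivative (a i)) ∈ S)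
    {a : Fin n → K[X]} (ha : a ∈ S) (ha0 : a ≠ 0) :
    ∃ c : Fin n → K, c ≠ 0 ∧ (fun i => C (c i)) ∈ S := by
  induction h : ∑ i, (a i).natDegree using Nat.strong_induction_on generalizing a with
  | _ N ih =>
    by_cases hd : (fun i => derivative (a i)) = 0
    · have hc : ∀ i, a i = C ((a i).coeff 0) := fun i =>
        eq_C_of_derivative_eq_zero (congrFun hd i)
      refine ⟨fun i => (a i).coeff 0, fun h0 => ha0 ?_, ?_⟩
      · funext i
        rw [hc i, show (a i).coeff 0 = 0 from congrFun h0 i]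
        simp
      · rwa [← funext hc]
    · refine ih _ ?_ (hS a ha) hd rfl
      rw [← h]
      obtain ⟨j, hj⟩ := Function.ne_iff.1 hd
      refine Finset.sum_lt_sum (fun i _ => ?_) ⟨j, Finset.mem_univ j, ?_⟩
      · exact (natDegree_derivative_le _).trans (Nat.sub_le _ _)
      · refine natDegree_derivative_lt fun h0 => hj ?_
        exact derivative_of_natDegree_zero h0

theorem det_wronskianMatrix_ne_zero [CharZero K] {n : ℕ} {b : Fin n → K[X]}
    (hb : LinearIndependent K b) : (wronskianMatrix b).det ≠ 0 := by
  intro hdet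
  let N : ℕ → Set (Fin n → K[X]) := fun m =>
    {a | ∀ k < m, ∑ i, a i * derivative^[k] (b i) = 0}
  obtain ⟨a, ha0, ha⟩ := Matrix.exists_mulVec_eq_zero_iff.2 hdet
  have haN : ∀ m ≤ n, a ∈ N m := by
    intro m hm k hk
    have := congrFun ha ⟨k, hk.trans_le hm⟩
    simpa [Matrix.mulVec, dotProduct, wronskianMatrix, mul_comm] using this
  -- If every inclusion `N (m + 1) ⊆ N m` were strict, witnesses would make the Wronskian matrix
  -- times another matrix triangular with nonzero diagonal, although its determinant is zero.
  have hstat : ∃ m < n, N m ⊆ N (m + 1) := by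
    by_contra! hcon
    have hA : ∀ m : Fin n, ∃ a ∈ N m, a ∉ N (m + 1) := fun m =>
      Set.not_subset.1 (hcon m m.2)
    choose A hA1 hA2 using hA
    have hM : ∀ k m : Fin n, (wronskianMatrix b * (Matrix.of A).transpose) k m =
        ∑ i, A m i * derivative^[k] (b i) := fun k m => by
      simp [Matrix.mul_apply, wronskianMatrix, mul_comm]
    have htri : (wronskianMatrix b * (Matrix.of A).transpose).BlockTriangular
        OrderDual.toDual := fun k m hkm => by
      rw [hM]
      exact hA1 m k hkm
    have h0 := Matrix.det_of_isLowerTriangular _ htri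
    rw [Matrix.det_mul, hdet, zero_mul, eq_comm, Finset.prod_eq_zero_iff] at h0
    obtain ⟨m, -, hm⟩ := h0
    rw [hM] at hm
    refine hA2 m fun k hk => ?_
    rcases Nat.lt_succ_iff_lt_or_eq.1 hk with hk | rfl
    · exact hA1 m k hk
    · exact hm
  obtain ⟨m, hm, hsub⟩ := hstat
  -- Differentiating the relation of order `k` leaves the one for `a'`, since stationarity kills the
  -- term of order `k + 1`.
  have hclosed : ∀ a ∈ N m, (fun i => derivative (a i)) ∈ N m := by
    intro a ha k hk
    have h1 : ∑ i, a i * derivative^[k] (b i) = 0 := ha k hk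
    have h2 := hsub ha (k + 1) (by omega)
    have h3 := congrArg derivative h1
    simp only [derivative_sum, derivative_mul, Finset.sum_add_distrib, derivative_zero] at h3
    simp only [Function.iterate_succ_apply'] at h2
    rwa [h2, add_zero] at h3
  obtain ⟨c, hc0, hc⟩ :=
    exists_constant_vector_of_derivative_closed _ hclosed (haN m hm.le) ha0
  -- Membership in `N (m + 1)` supplies the relation of order zero even if `m = 0`.
  have h0 := hsub hc 0 (by omega)
  refine hc0 (funext fun i => ?_)
  refine Fintype.linearIndependent_iff.1 hb c ?_ i
  simpa [smul_eq_C_mul] using h0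

/-- The Wronskian of `n ≥ 2` polynomials has degree less than the sum of their degrees. -/
theorem natDegree_det_wronskianMatrix_lt {n : ℕ} (hn : 2 ≤ n) (b : Fin n → K[X])
    (hW : (wronskianMatrix b).det ≠ 0) :
    (wronskianMatrix b).det.natDegree < ∑ i, (b i).natDegree := by
  suffices h : (wronskianMatrix b).det ∈ degreeLT K (∑ i, (b i).natDegree) by
    rw [mem_degreeLT] at h
    exact (natDegree_lt_iff_degree_lt hW).2 h
  rw [Matrix.det_apply]
  refine Submodule.sum_mem _ fun σ _ => ?_
  rw [Units.smul_def]
  refine zsmul_mem ?_ _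
  by_cases h0 : ∏ i, wronskianMatrix b (σ i) i = 0
  · rw [h0]
    exact zero_mem _
  rw [mem_degreeLT, ← natDegree_lt_iff_degree_lt h0, natDegree_prod _ _
    (Finset.prod_ne_zero_iff.1 h0)]
  -- The factor from row 1 is a first derivative, so its degree drops strictly.
  have hj := Finset.prod_ne_zero_iff.1 h0 (σ.symm ⟨1, hn⟩) (Finset.mem_univ _)
  refine Finset.sum_lt_sum (fun i _ => ?_) ⟨σ.symm ⟨1, hn⟩, Finset.mem_univ _, ?_⟩
  · exact (natDegree_iterate_derivative _ _).trans (Nat.sub_le _ _)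
  · simp only [wronskianMatrix, Matrix.of_apply, Equiv.apply_symm_apply,
      Function.iterate_one] at hj ⊢
    exact natDegree_derivative_lt fun h => hj (derivative_of_natDegree_zero h)

/-- Each of at most `n - 1` differentiations costs at most one factor `g i`, in every term of the
determinant expansion. -/
theorem prod_pow_dvd_det_wronskianMatrix_mul {n : ℕ} (g : Fin n → K[X]) (e : Fin n → ℕ) :
    ∏ i, g i ^ e i ∣ (wronskianMatrix fun i => g i ^ e i).det * ∏ i, g i ^ (n - 1) := by
  rw [Matrix.det_apply, Finset.sum_mul]
  refine Finset.dvd_sum fun σ _ => ?_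
  rw [smul_mul_assoc, Units.smul_def, zsmul_eq_mul, ← Finset.prod_mul_distrib]
  refine Dvd.dvd.mul_left (Finset.prod_dvd_prod_of_dvd _ _ fun i _ => ?_) _
  have h := pow_sub_dvd_iterate_derivative_pow (g i) (e i) (σ i)
  have hle : ((σ i : Fin n) : ℕ) ≤ n - 1 := by omega
  refine dvd_trans (pow_dvd_pow _ ?_) ((pow_add (g i) _ _).symm ▸ mul_dvd_mul h
    (pow_dvd_pow (g i) hle))
  omega

/-- The Wronskian of a tuple in the span of `b` is a constant multiple of that of `b`. -/
theorem det_wronskianMatrix_of_mem_span {n : ℕ} (b b' : Fin n → K[X])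
    (h : ∀ i, b' i ∈ Submodule.span K (Set.range b)) :
    ∃ c : K, (wronskianMatrix b').det = (wronskianMatrix b).det * C c := by
  simp only [Submodule.mem_span_range_iff_exists_fun] at h
  choose c hc using h
  refine ⟨(Matrix.of c).det, ?_⟩
  rw [RingHom.map_det, ← Matrix.det_transpose (RingHom.mapMatrix C _), ← Matrix.det_mul]
  congr 1
  ext1 k i
  simp only [wronskianMatrix, Matrix.mul_apply, ← hc, iterate_derivative_sum, Matrix.of_apply,
    RingHom.mapMatrix_apply, Matrix.transpose_apply, Matrix.map_apply]
  refine Finset.sum_congr rfl fun j _ => ?_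
  rw [iterate_derivative_smul, smul_eq_C_mul, mul_comm]

end

/-! ### Ear decompositions and the gcd of basis complements. -/

section
open Polynomial

variable {K : Type*} [Field K] {ι : Type*} [DecidableEq ι]

/-- The subset `B` of `E` indexes a basis of the span of `f i`, `i ∈ E`. -/
structure IsBasisOf (f : ι → K[X]) (B E : Finset ι) : Prop where
  subset : B ⊆ E
  indep : ∀ c : ι → K, ∑ i ∈ B, c i • f i = 0 → ∀ i ∈ B, c i = 0
  mem_span : ∀ i ∈ E, f i ∈ Submodule.span K (f '' B)

omit [DecidableEq ι] in
theorem sum_smul_mem_span (f : ι → K[X]) (E : Finset ι) (c : ι → K) :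
    ∑ i ∈ E, c i • f i ∈ Submodule.span K (f '' E) :=
  Submodule.sum_mem _ fun i hi => Submodule.smul_mem _ _
    (Submodule.subset_span ⟨i, hi, rfl⟩)

omit [DecidableEq ι] in
theorem IsBasisOf.span_eq {f : ι → K[X]} {B E : Finset ι} (h : IsBasisOf f B E) :
    Submodule.span K (f '' E) = Submodule.span K (f '' B) := by
  refine le_antisymm (Submodule.span_le.2 ?_) (Submodule.span_mono ?_)
  · rintro _ ⟨i, hi, rfl⟩
    exact h.mem_span i hi
  · exact Set.image_mono (by exact_mod_cast h.subset)

/-- `I` indexes a circuit modulo the span of `f i`, `i ∈ E`, with a relation whose value is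
a nonzero element of that span. -/
structure IsEar (f : ι → K[X]) (E I : Finset ι) (c : ι → K) : Prop where
  disjoint : Disjoint E I
  mem_span : ∑ i ∈ I, c i • f i ∈ Submodule.span K (f '' E)
  sum_ne_zero : ∑ i ∈ I, c i • f i ≠ 0
  coeff_ne_zero : ∀ i ∈ I, c i ≠ 0
  indep : ∀ e ∈ I, ∀ c' : ι → K, ∑ i ∈ I.erase e, c' i • f i ∈ Submodule.span K (f '' E) →
    ∀ i ∈ I.erase e, c' i = 0

theorem IsEar.nonempty {f : ι → K[X]} {E I : Finset ι} {c : ι → K} (h : IsEar f E I c) :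
    I.Nonempty := by
  rw [Finset.nonempty_iff_ne_empty]
  rintro rfl
  exact h.sum_ne_zero (by simp)

/-- The complement of `E` carries a relation of value `-∑ i ∈ E, f i ≠ 0`; a minimal set carrying
such a relation is an ear. -/
theorem exists_isEar [Fintype ι] {f : ι → K[X]} (hsum : ∑ i, f i = 0) {E : Finset ι}
    (hE : ∑ i ∈ E, f i ≠ 0) : ∃ I c, IsEar f E I c := by
  let P : Finset ι → Prop := fun I => Disjoint E I ∧ ∃ c : ι → K,
    ∑ i ∈ I, c i • f i ∈ Submodule.span K (f '' E) ∧ ∑ i ∈ I, c i • f i ≠ 0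
  have hP : P Eᶜ := by
    have h1 : ∑ i ∈ Eᶜ, f i = -∑ i ∈ E, f i := by
      rw [eq_neg_iff_add_eq_zero, add_comm, Finset.sum_add_sum_compl, hsum]
    refine ⟨disjoint_compl_right, 1, ?_, ?_⟩
    · simp only [Pi.one_apply, one_smul, h1]
      simpa using Submodule.neg_mem _ (sum_smul_mem_span f E 1)
    · simpa [h1] using hE
  obtain ⟨I, hI⟩ : ∃ I, Minimal P I := by
    obtain ⟨I, -, hI⟩ := exists_minimal_le_of_wellFoundedLT P _ hP
    exact ⟨I, hI⟩
  obtain ⟨⟨hdisj, c, hc1, hc2⟩, hmin⟩ := hI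
  have hmin' : ∀ e ∈ I, ∀ c' : ι → K,
      ∑ i ∈ I.erase e, c' i • f i ∈ Submodule.span K (f '' E) →
      ∑ i ∈ I.erase e, c' i • f i = 0 := by
    intro e he c' hc'
    by_contra h0
    have := hmin (y := I.erase e) ⟨hdisj.mono_right (I.erase_subset e), c', hc', h0⟩
      (I.erase_subset e)
    exact I.notMem_erase e (this he)
  refine ⟨I, c, hdisj, hc1, hc2, fun i hi h0 => ?_, fun e he c' hc' j hj => ?_⟩
  · have h1 : ∑ i ∈ I, c i • f i = ∑ i ∈ I.erase i, c i • f i := by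
      rw [← Finset.add_sum_erase _ _ hi, h0, zero_smul, zero_add]
    rw [h1] at hc1 hc2
    exact hc2 (hmin' i hi c hc1)
  · by_contra hj0
    have hjI := Finset.mem_of_mem_erase hj
    let c0 : ι → K := fun i => if i = e then 0 else c' i
    have hc0 : ∑ i ∈ I, c0 i • f i = 0 := by
      rw [← Finset.add_sum_erase _ _ he, ← hmin' e he c' hc']
      simp only [c0, if_true, zero_smul, zero_add]
      refine Finset.sum_congr rfl fun i hi => ?_
      rw [if_neg (Finset.ne_of_mem_erase hi)]
    -- Subtracting the multiple of the zero relation that kills coefficient `j` keeps the value,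
    -- contradicting minimality.
    let c2 : ι → K := fun i => c i - c j / c' j * c0 i
    have hc2I : ∑ i ∈ I, c2 i • f i = ∑ i ∈ I, c i • f i := by
      simp only [c2, sub_smul, mul_smul, Finset.sum_sub_distrib, ← Finset.smul_sum, hc0]
      simp
    have hc2j : c2 j = 0 := by
      simp only [c2, c0, if_neg (Finset.ne_of_mem_erase hj)]
      field_simp
      simp
    have h1 : ∑ i ∈ I, c i • f i = ∑ i ∈ I.erase j, c2 i • f i := by
      rw [← hc2I, ← Finset.add_sum_erase _ _ hjI, hc2j, zero_smul, zero_add]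
    rw [h1] at hc1 hc2
    exact hc2 (hmin' j hjI c2 hc1)

theorem IsBasisOf.union_ear {f : ι → K[X]} {B E I : Finset ι} {c : ι → K}
    (hB : IsBasisOf f B E) (hI : IsEar f E I c) {e : ι} (he : e ∈ I) :
    IsBasisOf f (B ∪ I.erase e) (E ∪ I) where
  subset := Finset.union_subset_union hB.subset (I.erase_subset e)
  indep := by
    intro a ha
    have hdisj : Disjoint B (I.erase e) := hI.disjoint.mono hB.subset (I.erase_subset e)
    rw [Finset.sum_union hdisj] at ha
    have h1 : ∑ i ∈ I.erase e, a i • f i ∈ Submodule.span K (f '' E) := by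
      rw [← neg_eq_of_add_eq_zero_right ha, hB.span_eq]
      exact Submodule.neg_mem _ (sum_smul_mem_span f B a)
    have h2 := hI.indep e he a h1
    rw [Finset.sum_eq_zero (s := I.erase e) fun i hi => by rw [h2 i hi, zero_smul],
      add_zero] at ha
    intro i hi
    rcases Finset.mem_union.1 hi with hi | hi
    · exact hB.indep a ha i hi
    · exact h2 i hi
  mem_span := by
    have hmono1 : Submodule.span K (f '' E) ≤ Submodule.span K (f '' ↑(B ∪ I.erase e)) := by
      rw [hB.span_eq]
      exact Submodule.span_mono (Set.image_mono (by simp))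
    have herase : ∀ i ∈ I.erase e, f i ∈ Submodule.span K (f '' ↑(B ∪ I.erase e)) :=
      fun i hi => Submodule.subset_span ⟨i, by
        rw [Finset.mem_coe]
        exact Finset.mem_union_right _ hi, rfl⟩
    intro i hi
    rcases Finset.mem_union.1 hi with hi | hi
    · exact hmono1 (Submodule.subset_span ⟨i, hi, rfl⟩)
    by_cases hie : i = e
    · subst hie
      have h1 := hmono1 hI.mem_span
      rw [← Finset.add_sum_erase _ _ hi, Submodule.add_mem_iff_left] at h1
      · exact (Submodule.smul_mem_iff _ (hI.coeff_ne_zero i hi)).1 h1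
      · exact Submodule.sum_mem _ fun j hj => Submodule.smul_mem _ _ (herase j hj)
    · exact herase i (Finset.mem_erase.2 ⟨hie, hi⟩)

omit [DecidableEq ι] in
theorem dvd_of_mem_span {f : ι → K[X]} {E : Finset ι} {p x : K[X]}
    (hp : ∀ i ∈ E, p ∣ f i) (hx : x ∈ Submodule.span K (f '' E)) : p ∣ x := by
  obtain ⟨c, rfl⟩ := (Submodule.mem_span_image_finset_iff_exists_fun' K).1 hx
  exact Finset.dvd_sum fun i hi => by
    rw [smul_eq_C_mul]
    exact (hp i hi).mul_left _

omit [DecidableEq ι] in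
theorem natDegree_le_of_mem_span {f : ι → K[X]} {E : Finset ι} {x : K[X]} {D : ℕ}
    (hD : ∀ i ∈ E, (f i).natDegree ≤ D) (hx : x ∈ Submodule.span K (f '' E)) :
    x.natDegree ≤ D := by
  obtain ⟨c, rfl⟩ := (Submodule.mem_span_image_finset_iff_exists_fun' K).1 hx
  exact natDegree_sum_le_of_forall_le _ _ fun i hi => (natDegree_smul_le _ _).trans (hD i hi)

omit [DecidableEq ι] in
/-- A finite family of polynomials has a greatest common divisor, also after
multiplication by any polynomial. -/
theorem exists_gcd_family {f : ι → K[X]} (I : Finset ι) :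
    ∃ g : K[X], (∀ i ∈ I, g ∣ f i) ∧
      ∀ p X : K[X], (∀ i ∈ I, p ∣ f i * X) → p ∣ g * X := by
  let J : Ideal K[X] := Ideal.span (f '' I)
  refine ⟨Submodule.IsPrincipal.generator J, fun i hi => ?_, fun p X h => ?_⟩
  · rw [← Submodule.IsPrincipal.mem_iff_generator_dvd]
    exact Ideal.subset_span ⟨i, hi, rfl⟩
  · obtain ⟨c, hc⟩ := (Submodule.mem_span_image_finset_iff_exists_fun' K[X]).1
      (Submodule.IsPrincipal.generator_mem J)
    rw [← hc, Finset.sum_mul]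
    refine Finset.dvd_sum fun i hi => ?_
    rw [smul_eq_mul, mul_assoc]
    exact (h i hi).mul_left _

/-- The degree of the projective point with coordinates `f i`, `i ∈ E`, is at most the difference
of the largest degree and the degree of the greatest common divisor of the products of the `f i`
over the complements in `E` of the bases. -/
def BasisComplementBound (f : ι → K[X]) (E : Finset ι) : Prop :=
  ∃ (G H : K[X]) (δ D : ℕ), G ≠ 0 ∧ H ≠ 0 ∧
    -- The spare factor `X` absorbs the ear's factors in the induction and later the Wronskian.
    (∀ p X : K[X], (∀ B, IsBasisOf f B E → p ∣ (∏ i ∈ E \ B, f i) * X) → p ∣ G * X) ∧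
    (∃ B, IsBasisOf f B E ∧ δ = ∑ i ∈ E \ B, (f i).natDegree) ∧
    (∀ i ∈ E, H ∣ f i) ∧ (∀ i ∈ E, (f i).natDegree ≤ D) ∧
    D + G.natDegree ≤ δ + H.natDegree

theorem basisComplementBound_singleton {f : ι → K[X]} {m : ι} (hm : f m ≠ 0) :
    BasisComplementBound f {m} := by
  have hB : IsBasisOf f {m} {m} := by
    refine ⟨subset_rfl, fun c hc i hi => ?_, fun i hi => Submodule.subset_span ⟨i, hi, rfl⟩⟩
    rw [Finset.mem_singleton.1 hi]
    simpa [hm] using hc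
  refine ⟨1, f m, 0, (f m).natDegree, one_ne_zero, hm, fun p X h => ?_, ⟨_, hB, by simp⟩,
    by simp, by simp, by simp⟩
  simpa using h _ hB

theorem union_sdiff_union_erase {E I B : Finset ι} (hEI : Disjoint E I) {e : ι}
    (hBE : B ⊆ E) (he : e ∈ I) : (E ∪ I) \ (B ∪ I.erase e) = insert e (E \ B) := by
  have h1 : ∀ x ∈ E, x ∉ I := fun x hx hx' => Finset.disjoint_left.1 hEI hx hx'
  ext x
  simp only [Finset.mem_sdiff, Finset.mem_union, Finset.mem_erase, Finset.mem_insert]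
  have h2 := h1 x
  have h3 := @hBE x
  by_cases hx : x = e
  · subst hx; tauto
  · tauto

/-- An ear's relation has a nonzero value lying in both spans. It is divisible by `lcm H g`, with
`g` the gcd over `I`, and its degree is at most both degree bounds. The inequality then follows from
`gcd * lcm = H * g` and `max + min = sum`. -/
theorem BasisComplementBound.union_ear {f : ι → K[X]} {E I : Finset ι} {c : ι → K}
    (h0 : ∀ i, f i ≠ 0) (hE : BasisComplementBound f E) (hI : IsEar f E I c) :
    BasisComplementBound f (E ∪ I) := by
  classical
  obtain ⟨G, H, δ, D, hG, hH, hgcd, ⟨B, hB, hδ⟩, hHd, hD, hle⟩ := hE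
  obtain ⟨g, hgd, hg⟩ := exists_gcd_family (f := f) I
  obtain ⟨e, he, hmax⟩ := Finset.exists_max_image I (fun i => (f i).natDegree) hI.nonempty
  have hg0 : g ≠ 0 := fun h => h0 e (zero_dvd_iff.1 (h ▸ hgd e he))
  have hsd : ∀ B, IsBasisOf f B E → ∀ i ∈ I,
      (E ∪ I) \ (B ∪ I.erase i) = insert i (E \ B) ∧ i ∉ E \ B := fun B hB i hi =>
    ⟨union_sdiff_union_erase hI.disjoint hB.subset hi, fun h =>
      Finset.disjoint_left.1 hI.disjoint (Finset.mem_sdiff.1 h).1 hi⟩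
  refine ⟨G * g, EuclideanDomain.gcd H g, δ + (f e).natDegree, max D (f e).natDegree,
    mul_ne_zero hG hg0, fun h => hH (EuclideanDomain.gcd_eq_zero_iff.1 h).1, ?_,
    ⟨_, hB.union_ear hI he, ?_⟩, ?_, ?_, ?_⟩
  · intro p X hp
    rw [mul_comm G g, mul_assoc]
    refine hg p _ fun i hi => ?_
    rw [mul_left_comm]
    refine hgcd p _ fun B hB => ?_
    have := hp _ (hB.union_ear hI hi)
    rw [(hsd B hB i hi).1, Finset.prod_insert (hsd B hB i hi).2] at this
    convert this using 1
    ring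
  · rw [(hsd B hB e he).1, Finset.sum_insert (hsd B hB e he).2, hδ, add_comm]
  · intro i hi
    rcases Finset.mem_union.1 hi with hi | hi
    · exact (EuclideanDomain.gcd_dvd_left _ _).trans (hHd i hi)
    · exact (EuclideanDomain.gcd_dvd_right _ _).trans (hgd i hi)
  · intro i hi
    rcases Finset.mem_union.1 hi with hi | hi
    · exact (hD i hi).trans (le_max_left _ _)
    · exact (hmax i hi).trans (le_max_right _ _)
  · have hw1 := dvd_of_mem_span hHd hI.mem_span
    have hw2 := dvd_of_mem_span hgd (sum_smul_mem_span f I c)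
    have hd1 := natDegree_le_of_mem_span hD hI.mem_span
    have hd2 := natDegree_le_of_mem_span hmax (sum_smul_mem_span f I c)
    have hl := natDegree_le_of_dvd (EuclideanDomain.lcm_dvd hw1 hw2) hI.sum_ne_zero
    have hgl := congrArg natDegree (EuclideanDomain.gcd_mul_lcm H g)
    rw [natDegree_mul hH hg0, natDegree_mul (fun h => hH (EuclideanDomain.gcd_eq_zero_iff.1 h).1)
      (fun h => (EuclideanDomain.lcm_eq_zero_iff.1 h).elim hH hg0)] at hgl
    rw [natDegree_mul hG hg0]
    omega

theorem exists_basisComplementBound [Fintype ι] {f : ι → K[X]} (h0 : ∀ i, f i ≠ 0)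
    (hsum : ∑ i, f i = 0) (m : ι) :
    ∃ E : Finset ι, m ∈ E ∧ ∑ i ∈ E, f i = 0 ∧ BasisComplementBound f E := by
  obtain ⟨E, hE⟩ := Set.Finite.exists_maximal
    (s := {E : Finset ι | m ∈ E ∧ BasisComplementBound f E}) (Set.toFinite _)
    ⟨{m}, Finset.mem_singleton_self m, basisComplementBound_singleton (h0 m)⟩
  refine ⟨E, hE.prop.1, ?_, hE.prop.2⟩
  by_contra hne
  obtain ⟨I, c, hI⟩ := exists_isEar hsum hne
  have hle := hE.le_of_ge (y := E ∪ I)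
    ⟨Finset.mem_union_left _ hE.prop.1, hE.prop.2.union_ear h0 hI⟩ Finset.subset_union_left
  obtain ⟨i, hi⟩ := hI.nonempty
  exact Finset.disjoint_left.1 hI.disjoint (hle (Finset.mem_union_right _ hi)) hi

end

/-! ### The degree inequality and the bound in one variable. -/

section
open Polynomial

variable {K : Type*} [Field K] {ι : Type*}

theorem IsBasisOf.linearIndependent {f : ι → K[X]} {B E : Finset ι} (h : IsBasisOf f B E) :
    LinearIndependent K (fun i : B => f i) :=
  linearIndepOn_finset_iff.2 h.indep

theorem IsBasisOf.card_eq {f : ι → K[X]} {B E : Finset ι} (h : IsBasisOf f B E) :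
    B.card = Module.finrank K (Submodule.span K (f '' E)) := by
  have h1 := finrank_span_eq_card h.linearIndependent
  rw [Fintype.card_coe] at h1
  rw [← h1, h.span_eq, Set.image_eq_range]
  rfl

/-- An enumeration of the polynomials `f i`, `i ∈ B`. -/
noncomputable def enumerate {d : ℕ} {α : Type*} (f : ι → α) (B : Finset ι) (h : B.card = d) :
    Fin d → α :=
  fun k => f ((B.equivFinOfCardEq h).symm k)

theorem range_enumerate {d : ℕ} {α : Type*} (f : ι → α) (B : Finset ι) (h : B.card = d) :
    Set.range (enumerate f B h) = f '' B := by
  rw [Set.image_eq_range]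
  exact (B.equivFinOfCardEq h).symm.surjective.range_comp fun i : B => f i

theorem prod_enumerate {d : ℕ} {α M : Type*} [CommMonoid M] (f : ι → α) (B : Finset ι)
    (h : B.card = d) (φ : α → M) : ∏ k, φ (enumerate f B h k) = ∏ i ∈ B, φ (f i) := by
  rw [← Finset.prod_coe_sort B]
  exact (B.equivFinOfCardEq h).symm.prod_comp fun i : B => φ (f i)

theorem sum_enumerate {d : ℕ} {α M : Type*} [AddCommMonoid M] (f : ι → α) (B : Finset ι)
    (h : B.card = d) (φ : α → M) : ∑ k, φ (enumerate f B h k) = ∑ i ∈ B, φ (f i) := by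
  rw [← Finset.sum_coe_sort B]
  exact (B.equivFinOfCardEq h).symm.sum_comp fun i : B => φ (f i)

theorem IsBasisOf.linearIndependent_enumerate {f : ι → K[X]} {B E : Finset ι} {d : ℕ}
    (h : IsBasisOf f B E) (hd : B.card = d) : LinearIndependent K (enumerate f B hd) :=
  h.linearIndependent.comp _ (B.equivFinOfCardEq hd).symm.injective

/-- The product of the `g i ^ e i` over a basis divides any Wronskian of the family times a power
of the product of the `g i`. -/
theorem IsBasisOf.prod_dvd [DecidableEq ι] {g : ι → K[X]} {e : ι → ℕ} {B E : Finset ι} {d : ℕ}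
    (h : IsBasisOf (fun i => g i ^ e i) B E) (hd : B.card = d) (b : Fin d → K[X])
    (hb : ∀ k, b k ∈ Submodule.span K ((fun i => g i ^ e i) '' E)) :
    ∏ i ∈ B, g i ^ e i ∣ (wronskianMatrix b).det * ∏ i ∈ E, g i ^ (d - 1) := by
  obtain ⟨c, hc⟩ := det_wronskianMatrix_of_mem_span (enumerate (fun i => g i ^ e i) B hd) b
    (fun k => by rw [range_enumerate, ← h.span_eq]; exact hb k)
  have h1 := prod_pow_dvd_det_wronskianMatrix_mul (enumerate g B hd) (enumerate e B hd)
  have h2 : ∏ k, enumerate g B hd k ^ enumerate e B hd k = ∏ i ∈ B, g i ^ e i :=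
    prod_enumerate (fun i => g i ^ e i) B hd id
  rw [prod_enumerate g B hd (fun x => x ^ (d - 1)), h2] at h1
  rw [hc, mul_right_comm]
  exact (h1.trans (mul_dvd_mul_left _ (Finset.prod_dvd_prod_of_subset _ _ _ h.subset))).mul_right _

/-- The degree bound for a family of powers satisfying `BasisComplementBound` whose greatest common
divisor is one. -/
theorem BasisComplementBound.natDegree_lt [CharZero K] [DecidableEq ι] {g : ι → K[X]} {e : ι → ℕ}
    {E : Finset ι} (h0 : ∀ i, g i ≠ 0) (hE : BasisComplementBound (fun i => g i ^ e i) E)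
    (hgcd : ∀ p, (∀ i ∈ E, p ∣ g i ^ e i) → IsUnit p) {d : ℕ}
    (hd : d = Module.finrank K (Submodule.span K ((fun i => g i ^ e i) '' E))) (hd2 : 2 ≤ d) :
    ∃ D, (∀ i ∈ E, (g i ^ e i).natDegree ≤ D) ∧ D < (d - 1) * ∑ i ∈ E, (g i).natDegree := by
  obtain ⟨G, H, δ, D, hG, hH, hp, ⟨B, hB, hδ⟩, hHd, hD, hle⟩ := hE
  refine ⟨D, hD, ?_⟩
  have hf0 : ∀ i, g i ^ e i ≠ 0 := fun i => pow_ne_zero _ (h0 i)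
  have hH1 := natDegree_eq_zero_of_isUnit (hgcd H hHd)
  have hBd : B.card = d := hB.card_eq.trans hd.symm
  let b := enumerate (fun i => g i ^ e i) B hBd
  have hbmem : ∀ k, b k ∈ Submodule.span K ((fun i => g i ^ e i) '' E) := fun k => by
    rw [hB.span_eq, ← range_enumerate _ _ hBd]
    exact Submodule.subset_span ⟨k, rfl⟩
  have hW : (wronskianMatrix b).det ≠ 0 :=
    det_wronskianMatrix_ne_zero (hB.linearIndependent_enumerate hBd)
  have hWdeg := (natDegree_det_wronskianMatrix_lt hd2 b hW).trans_eq
    (sum_enumerate _ B hBd natDegree)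
  -- Every basis `B'` gives this divisibility with its complementary product in place of `G`, for
  -- the same Wronskian.
  have hdvd : ∏ i ∈ E, g i ^ e i ∣ G * ((wronskianMatrix b).det * ∏ i ∈ E, g i ^ (d - 1)) := by
    refine hp _ _ fun B' hB' => ?_
    rw [← Finset.prod_sdiff hB'.subset]
    exact mul_dvd_mul_left _ (hB'.prod_dvd (hB'.card_eq.trans hd.symm) b hbmem)
  have hR0 : ∏ i ∈ E, g i ^ (d - 1) ≠ 0 :=
    Finset.prod_ne_zero_iff.2 fun i _ => pow_ne_zero _ (h0 i)
  have hdeg := natDegree_le_of_dvd hdvd (mul_ne_zero hG (mul_ne_zero hW hR0))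
  rw [natDegree_mul hG (mul_ne_zero hW hR0), natDegree_mul hW hR0,
    natDegree_prod _ _ fun i _ => hf0 i, natDegree_prod _ _ fun i _ => pow_ne_zero _ (h0 i)] at hdeg
  have hsplit := Finset.sum_sdiff (f := fun i => (g i ^ e i).natDegree) hB.subset
  simp only [natDegree_pow, ← Finset.mul_sum] at hdeg hsplit hδ hWdeg
  omega

/-- A nonconstant family with greatest common divisor one spans a space of dimension at least
two. -/
theorem two_le_finrank_span {f : ι → K[X]} {E : Finset ι} {m : ι} (hm : m ∈ E)
    (hdeg : (f m).natDegree ≠ 0) (hgcd : ∀ p, (∀ i ∈ E, p ∣ f i) → IsUnit p) :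
    2 ≤ Module.finrank K (Submodule.span K (f '' E)) := by
  by_contra! hlt
  have : Module.Finite K (Submodule.span K (f '' E)) :=
    Module.Finite.span_of_finite K (E.finite_toSet.image f)
  have hmem : ∀ i ∈ E, f i ∈ Submodule.span K (f '' E) := fun i hi =>
    Submodule.subset_span ⟨i, hi, rfl⟩
  have hfm : f m ≠ 0 := fun h => hdeg (by rw [h, natDegree_zero])
  have hone := finrank_le_one_iff.1 (Nat.lt_succ_iff.1 hlt)
  obtain ⟨v, hv⟩ := hone
  obtain ⟨a, ha⟩ := hv ⟨f m, hmem m hm⟩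
  have ha0 : a ≠ 0 := by
    rintro rfl
    exact hfm (by simpa using (congrArg Subtype.val ha).symm)
  -- In dimension one `f m` divides every `f i`, so it would be a unit.
  refine hdeg (natDegree_eq_zero_of_isUnit (hgcd _ fun i hi => ?_))
  obtain ⟨c, hc⟩ := hv ⟨f i, hmem i hi⟩
  have h1 : f m = a • (v : K[X]) := (congrArg Subtype.val ha).symm
  have h2 : f i = c • (v : K[X]) := (congrArg Subtype.val hc).symm
  refine ⟨C (c / a), ?_⟩
  rw [h1, h2, mul_comm, ← smul_eq_C_mul, smul_smul, div_mul_cancel₀ _ ha0]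

theorem sum_inv_exponents_gt [CharZero K] [Fintype ι] {g : ι → K[X]} {e : ι → ℕ}
    (he : ∀ i, 1 ≤ e i) {m : ι} (hm : (g m ^ e m).natDegree ≠ 0)
    (hsum : ∑ i, g i ^ e i = 0)
    (hgcd : ∀ I : Finset ι, I.Nonempty → ∑ i ∈ I, g i ^ e i = 0 →
      ∀ p, (∀ i ∈ I, p ∣ g i ^ e i) → IsUnit p) :
    2 ≤ Module.finrank K (Submodule.span K (Set.range fun i => g i ^ e i)) ∧
    1 / ((Module.finrank K (Submodule.span K (Set.range fun i => g i ^ e i)) : ℝ) - 1) <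
      ∑ i, 1 / (e i : ℝ) := by
  classical
  -- A zero term would be a vanishing subsum by itself, with the nonunit `X` as common divisor.
  have hf0 : ∀ i, g i ^ e i ≠ 0 := fun i h =>
    not_isUnit_X (hgcd {i} (Finset.singleton_nonempty i) (by simpa using h) X (by simp [h]))
  have hg0 : ∀ i, g i ≠ 0 := fun i h =>
    hf0 i (by rw [h, zero_pow (Nat.one_le_iff_ne_zero.1 (he i))])
  obtain ⟨E, hmE, hEsum, hE⟩ := exists_basisComplementBound hf0 hsum m
  have hEgcd := hgcd E ⟨m, hmE⟩ hEsum
  have h2 := two_le_finrank_span (f := fun i => g i ^ e i) hmE hm hEgcd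
  obtain ⟨D, hD, hlt⟩ := hE.natDegree_lt hg0 hEgcd rfl h2
  have : Module.Finite K (Submodule.span K (Set.range fun i => g i ^ e i)) :=
    Module.Finite.span_of_finite K (Set.finite_range _)
  have hle : Module.finrank K (Submodule.span K ((fun i => g i ^ e i) '' E)) ≤
      Module.finrank K (Submodule.span K (Set.range fun i => g i ^ e i)) :=
    Submodule.finrank_mono (Submodule.span_mono (Set.image_subset_range _ _))
  generalize Module.finrank K (Submodule.span K ((fun i => g i ^ e i) '' E)) = d at *
  generalize Module.finrank K (Submodule.span K (Set.range fun i => g i ^ e i)) = d' at *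
  refine ⟨h2.trans hle, ?_⟩
  have hDpos : (0 : ℝ) < D := by
    exact_mod_cast (Nat.pos_of_ne_zero hm).trans_le (hD m hmE)
  have hd1 : (0 : ℝ) < (d : ℝ) - 1 := by
    have : (2 : ℝ) ≤ d := by exact_mod_cast h2
    linarith
  have hlt' : (D : ℝ) < ((d : ℝ) - 1) * ∑ i ∈ E, ((g i).natDegree : ℝ) := by
    have h3 : (D : ℝ) < (((d - 1) * ∑ i ∈ E, (g i).natDegree : ℕ) : ℝ) := by exact_mod_cast hlt
    rwa [Nat.cast_mul, Nat.cast_sub (by omega), Nat.cast_one, Nat.cast_sum] at h3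
  have hdeg : ∑ i ∈ E, ((g i).natDegree : ℝ) ≤ D * ∑ i ∈ E, 1 / (e i : ℝ) := by
    rw [Finset.mul_sum]
    refine Finset.sum_le_sum fun i hi => ?_
    have hei : (0 : ℝ) < e i := by exact_mod_cast he i
    rw [mul_one_div, le_div_iff₀ hei]
    have := hD i hi
    rw [natDegree_pow, mul_comm] at this
    exact_mod_cast this
  have hkey : 1 / ((d : ℝ) - 1) < ∑ i ∈ E, 1 / (e i : ℝ) := by
    rw [div_lt_iff₀ hd1]
    have h3 := hlt'.trans_le (mul_le_mul_of_nonneg_left hdeg hd1.le)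
    refine lt_of_mul_lt_mul_left ?_ hDpos.le
    linarith
  calc 1 / ((d' : ℝ) - 1) ≤ 1 / ((d : ℝ) - 1) := by
        refine one_div_le_one_div_of_le hd1 (sub_le_sub_right ?_ _)
        exact_mod_cast hle
    _ < ∑ i ∈ E, 1 / (e i : ℝ) := hkey
    _ ≤ ∑ i, 1 / (e i : ℝ) := Finset.sum_le_sum_of_subset_of_nonneg (Finset.subset_univ _)
        fun i _ _ => by positivity

end

/-! ### Reduction from several variables to one. -/

section
open Polynomial

theorem finrank_span_range_comp_le {k K M N ι : Type*} [Field k] [Field K] [Algebra k K]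
    [AddCommGroup M] [Module k M] [AddCommGroup N] [Module k N] [Module K N]
    [IsScalarTower k K N] [Finite ι] (φ : M →ₗ[k] N) (f : ι → M) :
    Module.finrank K (Submodule.span K (Set.range fun i => φ (f i))) ≤
      Module.finrank k (Submodule.span k (Set.range f)) := by
  have : Module.Finite k (Submodule.span k (Set.range f)) :=
    Module.Finite.span_of_finite k (Set.finite_range f)
  let b := Module.finBasis k (Submodule.span k (Set.range f))
  have hle : Submodule.span K (Set.range fun i => φ (f i)) ≤
      Submodule.span K (Set.range fun j => φ (b j)) := by
    refine Submodule.span_le.2 ?_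
    rintro _ ⟨i, rfl⟩
    have h1 := b.sum_repr ⟨f i, Submodule.subset_span ⟨i, rfl⟩⟩
    have h2 := congrArg (fun x : Submodule.span k (Set.range f) => φ x) h1
    simp only [Submodule.coe_sum, Submodule.coe_smul, map_sum, map_smul] at h2
    change φ (f i) ∈ _
    rw [← h2]
    refine Submodule.sum_mem _ fun j _ => ?_
    rw [← algebraMap_smul K]
    exact Submodule.smul_mem _ _ (Submodule.subset_span ⟨j, rfl⟩)
  have : Module.Finite K (Submodule.span K (Set.range fun j => φ (b j))) :=
    Module.Finite.span_of_finite K (Set.finite_range _)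
  refine (Submodule.finrank_mono hle).trans ?_
  exact (finrank_range_le_card _).trans_eq (Fintype.card_fin _)

/-- Polynomials over a factorial ring `A` with no nontrivial common divisor have none over the
fraction field of `A`. -/
theorem isUnit_of_forall_dvd_map {A K ι : Type*} [CommRing A] [IsDomain A]
    [UniqueFactorizationMonoid A] [Field K] [Algebra A K] [IsFractionRing A K]
    {f : ι → A[X]} {I : Finset ι} (hne : ∃ i ∈ I, f i ≠ 0)
    (hf : ∀ p, (∀ i ∈ I, p ∣ f i) → IsUnit p) {p : K[X]}
    (hp : ∀ i ∈ I, p ∣ (f i).map (algebraMap A K)) : IsUnit p := by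
  have : IsGCDMonoid A := inferInstance
  let := Classical.arbitrary (NormalizedGCDMonoid A)
  have hinj : Function.Injective (algebraMap A K) := IsFractionRing.injective A K
  have hp0 : p ≠ 0 := by
    rintro rfl
    obtain ⟨i, hi, h0⟩ := hne
    exact h0 ((Polynomial.map_eq_zero_iff hinj).1 (zero_dvd_iff.1 (hp i hi)))
  obtain ⟨c, hc, hcp⟩ := IsLocalization.integerNormalization_spec (nonZeroDivisors A) p
  -- Clear denominators in `p` and take the primitive part: by Gauss's lemma it divides each `f i`
  -- already over `A`.
  refine isUnit_or_eq_zero_of_isUnit_integerNormalization_primPart hp0 (hf _ fun i hi => ?_)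
  refine (isPrimitive_primPart _).dvd_of_fraction_map_dvd_fraction_map (K := K) ?_
  refine (Polynomial.map_dvd _ (primPart_dvd _)).trans ?_
  have hc0 : algebraMap A K c ≠ 0 :=
    (map_ne_zero_iff _ hinj).2 (nonZeroDivisors.ne_zero hc)
  rw [hcp, ← algebraMap_smul K c p, smul_eq_C_mul]
  exact (isUnit_C.2 hc0.isUnit).mul_left_dvd.2 (hp i hi)

theorem exists_degreeOf_ne_zero {l : ℕ} {p : MvPolynomial (Fin l) ℂ}
    (hp : ¬ ∃ c, p = MvPolynomial.C c) : ∃ j, p.degreeOf j ≠ 0 := by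
  by_contra! h
  refine hp ⟨_, MvPolynomial.totalDegree_eq_zero_iff_eq_C.1 ?_⟩
  rw [MvPolynomial.totalDegree_eq_zero_iff]
  intro m hm x
  have := MvPolynomial.monomial_le_degreeOf x hm
  rw [h x] at this
  omega

/-- Multivariate polynomials as polynomials in the variable `j`. -/
noncomputable def polynomialInVariable {k : ℕ} (j : Fin (k + 1)) :
    MvPolynomial (Fin (k + 1)) ℂ ≃ₐ[ℂ] (MvPolynomial (Fin k) ℂ)[X] :=
  (MvPolynomial.renameEquiv ℂ (Equiv.swap 0 j)).trans (MvPolynomial.finSuccEquiv ℂ k)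

theorem natDegree_polynomialInVariable {k : ℕ} (j : Fin (k + 1))
    (p : MvPolynomial (Fin (k + 1)) ℂ) :
    (polynomialInVariable j p).natDegree = p.degreeOf j := by
  have h := MvPolynomial.degreeOf_rename_of_injective (p := p) (Equiv.swap 0 j).injective j
  rw [Equiv.swap_apply_right] at h
  rw [← h, ← MvPolynomial.natDegree_finSuccEquiv]
  rfl

end

theorem mainTheorem6 {l n : ℕ} (g : Fin n → MvPolynomial (Fin l) ℂ) (e : Fin n → ℕ)
    (he : ∀ i, 1 ≤ e i) (hf : MasonConditions (fun i => g i ^ e i))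
    (d : ℕ)
    (hd : d = Module.finrank ℂ (Submodule.span ℂ (Set.range (fun i => g i ^ e i)))) :
    2 ≤ d ∧ 1 / ((d : ℝ) - 1) < ∑ i, 1 / (e i : ℝ) := by
  obtain ⟨m, hm⟩ := not_forall.1 hf.not_all_constant
  -- The variable kept is one that occurs in the nonconstant `f m`, which therefore stays
  -- nonconstant over `K`.
  obtain ⟨j, hj⟩ := exists_degreeOf_ne_zero hm
  obtain _ | k := l
  · exact j.elim0
  let K := FractionRing (MvPolynomial (Fin k) ℂ)
  have : CharZero K :=
    charZero_of_injective_algebraMap (IsFractionRing.injective (MvPolynomial (Fin k) ℂ) K)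
  let φ : MvPolynomial (Fin (k + 1)) ℂ →ₐ[ℂ] Polynomial K :=
    (Polynomial.mapAlgHom (IsScalarTower.toAlgHom ℂ (MvPolynomial (Fin k) ℂ) K)).comp
      (polynomialInVariable j).toAlgHom
  have hφ : ∀ p, φ p = (polynomialInVariable j p).map (algebraMap _ K) := fun p => rfl
  have hinj : Function.Injective (algebraMap (MvPolynomial (Fin k) ℂ) K) :=
    IsFractionRing.injective _ _
  have hφinj : Function.Injective φ := fun p q hpq =>
    (polynomialInVariable j).injective (Polynomial.map_injective _ hinj hpq)
  have hne : ∀ i, g i ^ e i ≠ 0 := fun i h0 => by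
    exact not_isUnit_zero (hf.gcd_eq_one {i} (Finset.singleton_nonempty i) (by simpa using h0)
      0 (fun i' hi' => by rw [Finset.mem_singleton.1 hi', zero_dvd_iff]; exact h0))
  have hfin := finrank_span_range_comp_le (K := K) φ.toLinearMap fun i => g i ^ e i
  have hpow : (fun i => φ.toLinearMap (g i ^ e i)) = fun i => φ (g i) ^ e i := by
    funext i
    simp
  rw [hpow, ← hd] at hfin
  obtain ⟨h2, hlt⟩ := sum_inv_exponents_gt (g := fun i => φ (g i)) (m := m) he
    (by
      rw [← map_pow, hφ, Polynomial.natDegree_map_eq_of_injective hinj,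
        natDegree_polynomialInVariable]
      exact hj)
    (by simpa only [map_sum, map_pow, map_zero] using congrArg φ hf.sum_eq_zero)
    (by
      intro I hI hsum p hp
      have hsum' : ∑ i ∈ I, g i ^ e i = 0 := hφinj (by simpa using hsum)
      obtain ⟨i, hi⟩ := hI
      refine isUnit_of_forall_dvd_map (A := MvPolynomial (Fin k) ℂ) (I := I)
        (f := fun i => polynomialInVariable j (g i ^ e i))
        ⟨i, hi, (map_ne_zero_iff _ (polynomialInVariable j).injective).2 (hne i)⟩ ?_
        (fun i hi => by
          have := hp i hi
          rwa [← map_pow, hφ] at this)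
      intro q hq
      refine (MulEquiv.isUnit_map (polynomialInVariable j).symm).1
        (hf.gcd_eq_one I ⟨i, hi⟩ hsum' _ fun i hi => ?_)
      simpa using map_dvd (polynomialInVariable j).symm (hq i hi))
  generalize Module.finrank K (Submodule.span K (Set.range fun i => φ (g i) ^ e i)) = d' at *
  refine ⟨h2.trans hfin, lt_of_le_of_lt (one_div_le_one_div_of_le ?_ ?_) hlt⟩
  · have : (2 : ℝ) ≤ d' := by exact_mod_cast h2
    linarith
  · exact sub_le_sub_right (by exact_mod_cast hfin) _
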